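/- Let $\mathcal A,\mathcal B,\mathcal X,\mathcal Y$ be finite sets. A game $G=(q,H)$ consists of a probability distribution $q$ on $\mathcal A\times\mathcal B$ and a function $H:\mathcal A\times\mathcal B\times\mathcal X\times\mathcal Y\to[0,1]$; write $q(b)=\sum_a q(a,b)$ and $\mathbf P_q(a\mid b)=q(a,b)/q(b)$. A two-player (quantum) strategy $\Gamma$ consists of finite-dimensional complex Hilbert spaces $D,E$, an $\mathcal X$-valued POVM $\{R_a^x\}_x$ on $D$ for each $a\in\mathcal A$, a $\mathcal Y$-valued POVM $\{S_b^y\}_y$ on $E$ for each $b\in\mathcal B$, and a density operator $\gamma$ on $D\otimes E$. It achieves the correlation $p_{ab}^{xy}=\mathrm{Tr}[(R_a^x\otimes S_b^y)\gamma]$ and the score $\sum_{abxy}q(a,b)H(a,b,x,y)p_{ab}^{xy}$. A correlation is classical if it is achieved by some strategy whose state $\gamma$ is separable, and $\omega_c(G)$ is the maximum score at $G$ of classical correlations. Put $\rho_{ab}^{xy}=\mathrm{Tr}_D\big[\sqrt{R_a^x\otimes S_b^y}\,\gamma\,\sqrt{R_a^x\otimes S_b^y}\big]$, and for a finite family of positive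 semidefinite operators $\rho_i$ on a finite-dimensional Hilbert space let $\mathrm{Dist}\{\rho_i\}=\max\sum_i\mathrm{Tr}(T_i\rho_i)$, the maximum being over all POVMs $\{T_i\}$. Theorem. Let $G=(q,H)$ be a game with complete support, i.e. $q(a,b)>0$ for all $(a,b)\in\mathcal A\times\mathcal B$, let $\Gamma$ be any two-player strategy, and set $$\epsilon = 1-\sum_{a,b}q(a,b)\sum_y \mathrm{Dist}\{\rho_{ab}^{xy} : x\in\mathcal X\}.$$ Then the score achieved by $\Gamma$ exceeds $\omega_c(G)$ by at most $C_G\sqrt{\epsilon}$, where $$C_G=\frac32\sqrt{\sum_{a,b}\frac{q(b)}{\mathbf P_q(a\mid b)}}.$$ -/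

import Mathlib

open scoped BigOperators Kronecker MatrixOrder ComplexOrder

noncomputable section

namespace NonlocalGame

/-- A density operator on `ℂ^ι`: positive semidefinite with trace one. -/
def IsDensity {ι : Type*} [Fintype ι] (M : Matrix ι ι ℂ) : Prop :=
  M.PosSemidef ∧ M.trace = 1

/-- A family `(T x)`, indexed by a finite set of outcomes, is a POVM on `ℂ^ι`: all members are
positive semidefinite and they sum to the identity. -/
def IsPOVM {ι X : Type*} [DecidableEq ι] [Fintype X] (T : X → Matrix ι ι ℂ) : Prop :=
  (∀ x, (T x).PosSemidef) ∧ ∑ x, T x = 1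

/-- The partial trace `Tr_D` of an operator on `D ⊗ E`, for `D = ℂ^d` and `E = ℂ^e`. -/
def partialTraceLeft {d e : Type*} [Fintype d] (M : Matrix (d × e) (d × e) ℂ) : Matrix e e ℂ :=
  fun i j => ∑ k, M (k, i) (k, j)

/-- A density operator on `D ⊗ E` is separable if it is a finite convex combination of
product states. -/
def IsSeparable {d e : Type*} [Fintype d] [Fintype e] (γ : Matrix (d × e) (d × e) ℂ) : Prop :=
  ∃ (n : ℕ) (w : Fin n → ℝ) (α : Fin n → Matrix d d ℂ) (β : Fin n → Matrix e e ℂ),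
    (∀ k, 0 ≤ w k) ∧ ∑ k, w k = 1 ∧ (∀ k, IsDensity (α k)) ∧ (∀ k, IsDensity (β k)) ∧
      γ = ∑ k, (w k : ℂ) • (α k ⊗ₖ β k)

/-- `Dist {ρ i}` (Bob's optimal discrimination value): the maximum of `∑ i, Tr (T i * ρ i)` over all POVMs `T`
(a supremum over a compact set). -/
def optDist {ι X : Type*} [Fintype ι] [DecidableEq ι] [Fintype X] (ρ : X → Matrix ι ι ℂ) : ℝ :=
  sSup {r : ℝ | ∃ T : X → Matrix ι ι ℂ, IsPOVM T ∧ r = ∑ x, ((T x * ρ x).trace).re}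

/-- A two-player game `(q, H)`: a probability distribution `q` on input pairs and a scoring
function `H` with values in `[0, 1]`. -/
structure Game (A B X Y : Type*) [Fintype A] [Fintype B] where
  q : A → B → ℝ
  H : A → B → X → Y → ℝ
  q_nonneg : ∀ a b, 0 ≤ q a b
  q_sum : ∑ a, ∑ b, q a b = 1
  H_nonneg : ∀ a b x y, 0 ≤ H a b x y
  H_le_one : ∀ a b x y, H a b x y ≤ 1

namespace Game

variable {A B X Y : Type*} [Fintype A] [Fintype B]

/-- All input pairs occur with nonzero probability. -/
def CompleteSupport (G : Game A B X Y) : Prop := ∀ a b, 0 < G.q a b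

/-- The marginal `q(b)`. -/
def qB (G : Game A B X Y) (b : B) : ℝ := ∑ a, G.q a b

/-- The conditional probability `P_q(a | b)`. -/
def condProb (G : Game A B X Y) (a : A) (b : B) : ℝ := G.q a b / G.qB b

/-- The expected score of a correlation `p` at `G`. -/
def score [Fintype X] [Fintype Y] (G : Game A B X Y) (p : A → B → X → Y → ℝ) : ℝ :=
  ∑ a, ∑ b, ∑ x, ∑ y, G.q a b * G.H a b x y * p a b x y

/-- The constant `C_G`. -/
def errorConst (G : Game A B X Y) : ℝ :=
  (3 / 2) * Real.sqrt (∑ a, ∑ b, G.qB b * (G.condProb a b)⁻¹)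

end Game

/-- A two-player strategy on the finite-dimensional Hilbert spaces `D = ℂ^d` and `E = ℂ^e`. -/
structure Strategy (d e A B X Y : Type*) [Fintype d] [DecidableEq d] [Fintype e] [DecidableEq e]
    [Fintype X] [Fintype Y] where
  R : A → X → Matrix d d ℂ
  S : B → Y → Matrix e e ℂ
  γ : Matrix (d × e) (d × e) ℂ
  R_povm : ∀ a, IsPOVM (R a)
  S_povm : ∀ b, IsPOVM (S b)
  γ_density : IsDensity γ

namespace Strategy

variable {d e A B X Y : Type*} [Fintype d] [DecidableEq d] [Fintype e] [DecidableEq e]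
  [Fintype X] [Fintype Y]

/-- The correlation `Tr[(R_a^x ⊗ S_b^y) γ]` achieved by a strategy. -/
def correlation (Γ : Strategy d e A B X Y) (a : A) (b : B) (x : X) (y : Y) : ℝ :=
  (((Γ.R a x ⊗ₖ Γ.S b y) * Γ.γ).trace).re

/-- The second player states `Tr_D[√(R_a^x ⊗ S_b^y) γ √(R_a^x ⊗ S_b^y)]`. -/
def secondPlayerState (Γ : Strategy d e A B X Y) (a : A) (b : B) (x : X) (y : Y) :
    Matrix e e ℂ :=
  partialTraceLeft
    (CFC.sqrt (Γ.R a x ⊗ₖ Γ.S b y) * Γ.γ * CFC.sqrt (Γ.R a x ⊗ₖ Γ.S b y))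

/-- The quantity `ε = 1 - ∑_{ab} q(a,b) ∑_y Dist {ρ_{ab}^{xy} | x}`. -/
def unguessability [Fintype A] [Fintype B] (Γ : Strategy d e A B X Y) (G : Game A B X Y) : ℝ :=
  1 - ∑ a, ∑ b, G.q a b * ∑ y, optDist (fun x => Γ.secondPlayerState a b x y)

end Strategy

/-- A correlation is classical if it is achieved by a strategy whose shared state is separable. -/
def IsClassical {A B X Y : Type*} [Fintype X] [Fintype Y] (p : A → B → X → Y → ℝ) : Prop :=
  ∃ (m n : ℕ) (Γ : Strategy (Fin m) (Fin n) A B X Y), IsSeparable Γ.γ ∧ p = Γ.correlation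

/-- The classical value `ω_c(G)`: the maximum score achieved at `G` by classical correlations. -/
def Game.classicalValue {A B X Y : Type*} [Fintype A] [Fintype B] [Fintype X] [Fintype Y]
    (G : Game A B X Y) : ℝ :=
  sSup {s : ℝ | ∃ p : A → B → X → Y → ℝ, IsClassical p ∧ s = G.score p}

end NonlocalGame

end

/-! If the second player can guess the first player's outcome, measuring `R a` hardly disturbs the
state. All the `R a` can then be measured one after another on `D`, giving a single measurement `M`
whose outcome `ω` supplies a reply `r a ω` to every input. Since `M` does not depend on the input,
`ω` acts as shared randomness and the resulting correlation is classical
(`isClassical_of_joint_measurement`).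

The disturbance estimate is `sq_trace_disturbance_le`: a measurement `T` on `E` that predicts `R`
can replace it almost exactly, and `T` leaves effects on `D` unchanged. Conditioning on `y` and
applying Cauchy–Schwarz gives an error of at most `√2 √(ε a' b)` for each measurement `R a'`. These
errors add up along the sequence (`exists_joint_measurement`), and a weighted Cauchy–Schwarz
inequality (`sum_qB_mul_sqrt_le`) turns their average into `C_G √ε`. -/

namespace NonlocalGame

open Matrix

/-! ### Positive operators on tensor products and the disturbance bound. -/

section MatrixLemmas

lemma sum_kronecker {d e ι : Type*} (s : Finset ι) (M : ι → Matrix d d ℂ) (N : Matrix e e ℂ) :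
    (∑ i ∈ s, M i) ⊗ₖ N = ∑ i ∈ s, M i ⊗ₖ N := by
  ext i j
  simp [Matrix.sum_apply, Finset.sum_mul]

lemma kronecker_sum {d e ι : Type*} (s : Finset ι) (M : Matrix d d ℂ) (N : ι → Matrix e e ℂ) :
    M ⊗ₖ (∑ i ∈ s, N i) = ∑ i ∈ s, M ⊗ₖ N i := by
  ext i j
  simp [Matrix.sum_apply, Finset.mul_sum]

lemma sub_kronecker {d e : Type*} (M M' : Matrix d d ℂ) (N : Matrix e e ℂ) :
    (M - M') ⊗ₖ N = M ⊗ₖ N - M' ⊗ₖ N := by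
  ext i j
  simp [sub_mul]

lemma kronecker_sub {d e : Type*} (M : Matrix d d ℂ) (N N' : Matrix e e ℂ) :
    M ⊗ₖ (N - N') = M ⊗ₖ N - M ⊗ₖ N' := by
  ext i j
  simp [mul_sub]

lemma IsPOVM.posSemidef_one_sub {n X : Type*} [DecidableEq n] [Fintype X] {T : X → Matrix n n ℂ}
    (hT : IsPOVM T) (x : X) : (1 - T x).PosSemidef := by
  classical
  rw [← hT.2, ← Finset.add_sum_erase _ _ (Finset.mem_univ x), add_sub_cancel_left]
  exact posSemidef_sum _ fun y _ => hT.1 y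

lemma posSemidef_partialTraceLeft {d e : Type*} [Fintype d] {M : Matrix (d × e) (d × e) ℂ}
    (hM : M.PosSemidef) : (partialTraceLeft M).PosSemidef := by
  have : partialTraceLeft M = ∑ k, M.submatrix (fun i => (k, i)) (fun i => (k, i)) := by
    ext i j
    simp [partialTraceLeft, Matrix.sum_apply]
  rw [this]
  exact posSemidef_sum _ fun k _ => hM.submatrix _

variable {n d e X : Type*} [Fintype n] [DecidableEq n] [Fintype d] [DecidableEq d]
  [Fintype e] [DecidableEq e] [Fintype X]

omit [DecidableEq d] [DecidableEq e] in
lemma posSemidef_kronecker {M : Matrix d d ℂ} {N : Matrix e e ℂ} (hM : M.PosSemidef)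
    (hN : N.PosSemidef) : (M ⊗ₖ N).PosSemidef :=
  hM.kronecker hN

lemma trace_mul_re_nonneg {M γ : Matrix n n ℂ} (hM : M.PosSemidef) (hγ : γ.PosSemidef) :
    0 ≤ (M * γ).trace.re := by
  obtain ⟨B, rfl⟩ := CStarAlgebra.nonneg_iff_eq_star_mul_self.mp hγ.nonneg
  rw [← mul_assoc, trace_mul_comm, ← mul_assoc]
  have := (hM.mul_mul_conjTranspose_same B).trace_nonneg
  exact (Complex.le_def.mp this).1

lemma posSemidef_sqrt (M : Matrix n n ℂ) : (CFC.sqrt M).PosSemidef :=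
  (CFC.sqrt_nonneg M).posSemidef

lemma sqrt_mul_self_of_posSemidef {M : Matrix n n ℂ} (hM : M.PosSemidef) :
    CFC.sqrt M * CFC.sqrt M = M :=
  CFC.sqrt_mul_sqrt_self M hM.nonneg

lemma sqrt_kronecker {R : Matrix d d ℂ} {S : Matrix e e ℂ} (hR : R.PosSemidef)
    (hS : S.PosSemidef) : CFC.sqrt (R ⊗ₖ S) = CFC.sqrt R ⊗ₖ CFC.sqrt S := by
  refine CFC.sqrt_unique ?_ ((posSemidef_sqrt R).kronecker (posSemidef_sqrt S)).nonneg
  rw [← mul_kronecker_mul, sqrt_mul_self_of_posSemidef hR, sqrt_mul_self_of_posSemidef hS]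

open scoped Matrix.Norms.L2Operator in
lemma posSemidef_one_sub_sqrt {M : Matrix n n ℂ} (hM : (1 - M).PosSemidef) :
    (1 - CFC.sqrt M).PosSemidef := by
  have h := CFC.sqrt_le_sqrt M 1 (Matrix.le_iff.mpr hM)
  rw [CFC.sqrt_one] at h
  exact Matrix.le_iff.mp h

/-- Holds because `M - M² = M(1 - M)M + (1 - M)M(1 - M)`. -/
lemma posSemidef_sub_mul_self {M : Matrix n n ℂ} (hM : M.PosSemidef) (hM' : (1 - M).PosSemidef) :
    (M - M * M).PosSemidef := by
  have h1 := hM'.mul_mul_conjTranspose_same M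
  have h2 := hM.mul_mul_conjTranspose_same (1 - M)
  rw [hM.isHermitian.eq] at h1
  rw [hM'.isHermitian.eq] at h2
  convert h1.add h2 using 1
  noncomm_ring

/-- `√R ⊗ √T ≥ R ⊗ T` for effects `R` and `T`. -/
lemma posSemidef_sqrt_kronecker_sqrt_sub {R : Matrix d d ℂ} {T : Matrix e e ℂ}
    (hR : R.PosSemidef) (hR' : (1 - R).PosSemidef) (hT : T.PosSemidef)
    (hT' : (1 - T).PosSemidef) :
    (CFC.sqrt R ⊗ₖ CFC.sqrt T - R ⊗ₖ T).PosSemidef := by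
  have h1 := posSemidef_sub_mul_self (posSemidef_sqrt R) (posSemidef_one_sub_sqrt hR')
  have h2 := posSemidef_sub_mul_self (posSemidef_sqrt T) (posSemidef_one_sub_sqrt hT')
  rw [sqrt_mul_self_of_posSemidef hR] at h1
  rw [sqrt_mul_self_of_posSemidef hT] at h2
  have := (posSemidef_kronecker h1 (posSemidef_sqrt T)).add (posSemidef_kronecker hR h2)
  rwa [sub_kronecker, kronecker_sub, sub_add_sub_cancel] at this

/-- Two measurements whose square roots commute and overlap well on a state `γ` disturb an
effect `Z` by nearly the same amount. -/
lemma sq_sum_trace_conj_sub_conj_le {γ Z : Matrix n n ℂ} {A B : X → Matrix n n ℂ}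
    (hγ : γ.PosSemidef) (hZ : Z.PosSemidef) (hZ' : (1 - Z).PosSemidef)
    (hA : ∀ x, (A x).IsHermitian) (hB : ∀ x, (B x).IsHermitian)
    (hAA : ∑ x, A x * A x = 1) (hBB : ∑ x, B x * B x = 1)
    (hAB : ∀ x, B x * A x = A x * B x) :
    (∑ x, ((B x * Z * B x - A x * Z * A x) * γ).trace.re) ^ 2
      ≤ γ.trace.re ^ 2 - (∑ x, ((A x * B x) * γ).trace.re) ^ 2 := by
  set K := ∑ x, ((B x * Z * B x - A x * Z * A x) * γ).trace.re with hK
  set c := ∑ x, ((A x * B x) * γ).trace.re with hc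
  set p := γ.trace.re with hp
  have hpA : ∑ x, ((A x * A x) * γ).trace.re = p := by
    rw [← Complex.re_sum, ← trace_sum, ← Finset.sum_mul, hAA, one_mul]
  have hpB : ∑ x, ((B x * B x) * γ).trace.re = p := by
    rw [← Complex.re_sum, ← trace_sum, ← Finset.sum_mul, hBB, one_mul]
  -- Cauchy–Schwarz for the pairing of `B - A` with `B + A` through the contraction `1 - 2Z`, in
  -- discriminant form. The squared norms are `2p - 2c` and `2p + 2c`. In the cross term `∑ B²` and
  -- `∑ A²` cancel, leaving `-4K`. Splitting `1 - 2Z` as `(1 - Z) - Z` makes positivity visible.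
  have key : ∀ t : ℝ, 0 ≤ (2 * p - 2 * c) * (t * t) + (-(4 * K)) * t + (2 * p + 2 * c) := by
    intro t
    have hU : ∀ x, ((t : ℂ) • (B x - A x) + (B x + A x)).IsHermitian := fun x => by
      have := hA x; have := hB x
      simp_all [Matrix.IsHermitian, conjTranspose_smul]
    have hV : ∀ x, ((t : ℂ) • (B x - A x) - (B x + A x)).IsHermitian := fun x => by
      have := hA x; have := hB x
      simp_all [Matrix.IsHermitian, conjTranspose_smul]
    have h1 : ∀ x, 0 ≤ ((((t : ℂ) • (B x - A x) + (B x + A x)) * (1 - Z) *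
        ((t : ℂ) • (B x - A x) + (B x + A x)) + ((t : ℂ) • (B x - A x) - (B x + A x)) * Z *
        ((t : ℂ) • (B x - A x) - (B x + A x))) * γ).trace.re := fun x => by
      refine trace_mul_re_nonneg ?_ hγ
      have h1 := hZ'.mul_mul_conjTranspose_same ((t : ℂ) • (B x - A x) + (B x + A x))
      have h2 := hZ.mul_mul_conjTranspose_same ((t : ℂ) • (B x - A x) - (B x + A x))
      rw [hU x] at h1
      rw [hV x] at h2
      exact h1.add h2
    have h2 := Finset.sum_nonneg fun x (_ : x ∈ Finset.univ) => h1 x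
    have hexp : ∀ x, ((t : ℂ) • (B x - A x) + (B x + A x)) * (1 - Z) *
        ((t : ℂ) • (B x - A x) + (B x + A x)) + ((t : ℂ) • (B x - A x) - (B x + A x)) * Z *
        ((t : ℂ) • (B x - A x) - (B x + A x)) =
        ((t ^ 2 + 1 + 2 * t : ℝ) : ℂ) • (B x * B x) + ((t ^ 2 + 1 - 2 * t : ℝ) : ℂ) • (A x * A x)
        - ((2 * (t ^ 2 - 1) : ℝ) : ℂ) • (A x * B x)
        - ((4 * t : ℝ) : ℂ) • (B x * Z * B x - A x * Z * A x) := fun x => by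
      have := hAB x
      simp only [mul_add, add_mul, sub_mul, mul_sub, smul_add, smul_sub, smul_mul_assoc,
        mul_smul_comm, mul_one, smul_smul, mul_assoc, this]
      push_cast
      module
    have hterm : ∀ x, ((((t : ℂ) • (B x - A x) + (B x + A x)) * (1 - Z) *
        ((t : ℂ) • (B x - A x) + (B x + A x)) + ((t : ℂ) • (B x - A x) - (B x + A x)) * Z *
        ((t : ℂ) • (B x - A x) - (B x + A x))) * γ).trace.re =
        (t ^ 2 + 1 + 2 * t) * ((B x * B x) * γ).trace.re
        + (t ^ 2 + 1 - 2 * t) * ((A x * A x) * γ).trace.re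
        - (2 * (t ^ 2 - 1)) * ((A x * B x) * γ).trace.re
        - (4 * t) * ((B x * Z * B x - A x * Z * A x) * γ).trace.re := fun x => by
      rw [hexp, sub_mul, sub_mul, add_mul, trace_sub, trace_sub, trace_add]
      simp only [smul_mul_assoc, trace_smul, smul_eq_mul, Complex.sub_re, Complex.add_re,
        Complex.re_ofReal_mul]
    simp only [hterm, Finset.sum_sub_distrib, Finset.sum_add_distrib, ← Finset.mul_sum] at h2
    rw [hpA, hpB, ← hc, ← hK] at h2
    linarith
  have := discrim_le_zero key
  rw [discrim] at this
  nlinarith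

/-- If an outcome of `R` on the first system can be guessed by measuring `T` on the second, then
performing `R` hardly changes the expectation of a first-system effect `Z`. -/
lemma sq_trace_disturbance_le {γ : Matrix (d × e) (d × e) ℂ} {Z : Matrix d d ℂ}
    {R : X → Matrix d d ℂ} {T : X → Matrix e e ℂ}
    (hγ : γ.PosSemidef) (hZ : Z.PosSemidef) (hZ' : (1 - Z).PosSemidef)
    (hR : IsPOVM R) (hT : IsPOVM T) :
    ((((Z - ∑ x, CFC.sqrt (R x) * Z * CFC.sqrt (R x)) ⊗ₖ (1 : Matrix e e ℂ)) * γ).trace.re) ^ 2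
        ≤ 2 * γ.trace.re * (γ.trace.re - ∑ x, ((R x ⊗ₖ T x) * γ).trace.re) ∧
      ∑ x, ((R x ⊗ₖ T x) * γ).trace.re ≤ γ.trace.re := by
  have h1 : (1 - Z ⊗ₖ (1 : Matrix e e ℂ)).PosSemidef := by
    have := posSemidef_kronecker hZ' (PosSemidef.one (n := e) (R := ℂ))
    rwa [sub_kronecker, one_kronecker_one] at this
  have hA : ∀ x, (CFC.sqrt (R x) ⊗ₖ (1 : Matrix e e ℂ)).IsHermitian := fun x =>
    ((posSemidef_sqrt (R x)).kronecker PosSemidef.one).isHermitian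
  have hB : ∀ x, ((1 : Matrix d d ℂ) ⊗ₖ CFC.sqrt (T x)).IsHermitian := fun x =>
    (PosSemidef.one.kronecker (posSemidef_sqrt (T x))).isHermitian
  have hAA : ∑ x, (CFC.sqrt (R x) ⊗ₖ (1 : Matrix e e ℂ)) * (CFC.sqrt (R x) ⊗ₖ 1) = 1 := by
    simp only [← mul_kronecker_mul, sqrt_mul_self_of_posSemidef (hR.1 _), mul_one]
    rw [← sum_kronecker, hR.2, one_kronecker_one]
  have hBB : ∑ x, ((1 : Matrix d d ℂ) ⊗ₖ CFC.sqrt (T x)) * (1 ⊗ₖ CFC.sqrt (T x)) = 1 := by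
    simp only [← mul_kronecker_mul, sqrt_mul_self_of_posSemidef (hT.1 _), mul_one]
    rw [← kronecker_sum, hT.2, one_kronecker_one]
  have hAB : ∀ x, ((1 : Matrix d d ℂ) ⊗ₖ CFC.sqrt (T x)) * (CFC.sqrt (R x) ⊗ₖ 1) =
      (CFC.sqrt (R x) ⊗ₖ 1) * (1 ⊗ₖ CFC.sqrt (T x)) := fun x => by
    simp only [← mul_kronecker_mul, one_mul, mul_one]
  have key := sq_sum_trace_conj_sub_conj_le hγ (hZ.kronecker (PosSemidef.one (n := e) (R := ℂ)))
    h1 hA hB hAA hBB hAB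
  simp only [← mul_kronecker_mul, one_mul, mul_one] at key
  -- The operators `1 ⊗ √T` commute with `Z ⊗ 1`, so measuring `T` causes no disturbance.
  have hK : ∑ x, ((Z ⊗ₖ (CFC.sqrt (T x) * CFC.sqrt (T x)) -
      (CFC.sqrt (R x) * Z * CFC.sqrt (R x)) ⊗ₖ (1 : Matrix e e ℂ)) * γ).trace.re =
      (((Z - ∑ x, CFC.sqrt (R x) * Z * CFC.sqrt (R x)) ⊗ₖ (1 : Matrix e e ℂ)) * γ).trace.re := by
    rw [← Complex.re_sum, ← trace_sum, ← Finset.sum_mul, Finset.sum_sub_distrib,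
      ← sum_kronecker, ← kronecker_sum]
    simp only [sqrt_mul_self_of_posSemidef (hT.1 _)]
    rw [hT.2]
    rw [sub_kronecker]
  rw [hK] at key
  have hc : ∑ x, ((R x ⊗ₖ T x) * γ).trace.re
      ≤ ∑ x, ((CFC.sqrt (R x) ⊗ₖ CFC.sqrt (T x)) * γ).trace.re := by
    refine Finset.sum_le_sum fun x _ => ?_
    have := trace_mul_re_nonneg (posSemidef_sqrt_kronecker_sqrt_sub (hR.1 x)
      (hR.posSemidef_one_sub x) (hT.1 x) (hT.posSemidef_one_sub x)) hγ
    rw [sub_mul, trace_sub, Complex.sub_re] at this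
    linarith
  have h0 : 0 ≤ ∑ x, ((R x ⊗ₖ T x) * γ).trace.re := Finset.sum_nonneg fun x _ =>
    trace_mul_re_nonneg ((hR.1 x).kronecker (hT.1 x)) hγ
  have hp : 0 ≤ γ.trace.re := (Complex.le_def.mp hγ.trace_nonneg).1
  set c := ∑ x, ((CFC.sqrt (R x) ⊗ₖ CFC.sqrt (T x)) * γ).trace.re
  set v := ∑ x, ((R x ⊗ₖ T x) * γ).trace.re
  set K := (((Z - ∑ x, CFC.sqrt (R x) * Z * CFC.sqrt (R x)) ⊗ₖ (1 : Matrix e e ℂ)) * γ).trace.re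
  -- Nonnegativity of the squared disturbance in `key` already forces `c² ≤ p²`.
  have hcp : c ≤ γ.trace.re := abs_le_of_sq_le_sq' (by nlinarith [sq_nonneg K]) hp |>.2
  refine ⟨?_, hc.trans hcp⟩
  -- `p² - c² = (p - c)(p + c) ≤ 2p(p - v)`, since `0 ≤ v ≤ c ≤ p`.
  nlinarith

omit [DecidableEq e] in
lemma trace_mul_partialTraceLeft (T : Matrix e e ℂ) (M : Matrix (d × e) (d × e) ℂ) :
    (T * partialTraceLeft M).trace = (((1 : Matrix d d ℂ) ⊗ₖ T) * M).trace := by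
  simp only [trace, diag_apply, mul_apply, partialTraceLeft, kronecker_apply,
    Fintype.sum_prod_type, one_apply, ite_mul, one_mul, zero_mul, Finset.mul_sum,
    Finset.sum_ite_irrel, Finset.sum_const_zero]
  simp only [Finset.sum_ite_eq, Finset.mem_univ, if_true]
  rw [eq_comm, Finset.sum_comm]
  exact Finset.sum_congr rfl fun _ _ => Finset.sum_comm

end MatrixLemmas

/-! ### Conditioning on the second player's outcome. -/

namespace Strategy

variable {d e A B X Y : Type*} [Fintype d] [DecidableEq d] [Fintype e] [DecidableEq e]
  [Fintype X] [Fintype Y]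

/-- The subnormalized state of `D ⊗ E` after the second player obtains the outcome `y` of the
measurement `S b`. -/
noncomputable def measuredState (Γ : Strategy d e A B X Y) (b : B) (y : Y) :
    Matrix (d × e) (d × e) ℂ :=
  ((1 : Matrix d d ℂ) ⊗ₖ CFC.sqrt (Γ.S b y)) * Γ.γ * ((1 : Matrix d d ℂ) ⊗ₖ CFC.sqrt (Γ.S b y))

lemma posSemidef_measuredState (Γ : Strategy d e A B X Y) (b : B) (y : Y) :
    (Γ.measuredState b y).PosSemidef := by
  have h := posSemidef_kronecker (PosSemidef.one (n := d) (R := ℂ)) (posSemidef_sqrt (Γ.S b y))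
  have := Γ.γ_density.1.mul_mul_conjTranspose_same ((1 : Matrix d d ℂ) ⊗ₖ CFC.sqrt (Γ.S b y))
  rwa [h.isHermitian.eq] at this

lemma trace_kronecker_one_mul_measuredState (Γ : Strategy d e A B X Y) (b : B) (y : Y)
    (W : Matrix d d ℂ) :
    ((W ⊗ₖ (1 : Matrix e e ℂ)) * Γ.measuredState b y).trace
      = ((W ⊗ₖ Γ.S b y) * Γ.γ).trace := by
  rw [measuredState, ← mul_assoc, trace_mul_comm, ← mul_assoc, ← mul_assoc, ← mul_kronecker_mul,
    ← mul_kronecker_mul, one_mul, mul_one, mul_one,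
    sqrt_mul_self_of_posSemidef ((Γ.S_povm b).1 y)]

/-- The root of `R ⊗ S` factors into commuting local roots, so the second player's state comes from
measuring `R` on the measured state. Guessing probabilities thus become the overlaps in
`sq_trace_disturbance_le`. -/
lemma trace_mul_secondPlayerState (Γ : Strategy d e A B X Y) (a : A) (b : B) (x : X) (y : Y)
    (T : Matrix e e ℂ) :
    (T * Γ.secondPlayerState a b x y).trace
      = ((Γ.R a x ⊗ₖ T) * Γ.measuredState b y).trace := by
  have hR := (Γ.R_povm a).1 x
  have hsplit : CFC.sqrt (Γ.R a x ⊗ₖ Γ.S b y) =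
      (CFC.sqrt (Γ.R a x) ⊗ₖ 1) * (1 ⊗ₖ CFC.sqrt (Γ.S b y)) := by
    rw [sqrt_kronecker hR ((Γ.S_povm b).1 y), ← mul_kronecker_mul, one_mul, mul_one]
  have hsplit' : CFC.sqrt (Γ.R a x ⊗ₖ Γ.S b y) =
      (1 ⊗ₖ CFC.sqrt (Γ.S b y)) * (CFC.sqrt (Γ.R a x) ⊗ₖ 1) := by
    rw [sqrt_kronecker hR ((Γ.S_povm b).1 y), ← mul_kronecker_mul, one_mul, mul_one]
  have hstate : CFC.sqrt (Γ.R a x ⊗ₖ Γ.S b y) * Γ.γ * CFC.sqrt (Γ.R a x ⊗ₖ Γ.S b y) =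
      (CFC.sqrt (Γ.R a x) ⊗ₖ 1) * Γ.measuredState b y * (CFC.sqrt (Γ.R a x) ⊗ₖ 1) := by
    conv_lhs => rw [hsplit]
    rw [← hsplit, hsplit']
    conv_lhs => enter [1, 1]; rw [← hsplit', hsplit]
    simp only [measuredState, mul_assoc]
  rw [secondPlayerState, trace_mul_partialTraceLeft, hstate, ← mul_assoc, trace_mul_comm,
    ← mul_assoc, ← mul_assoc, ← mul_kronecker_mul, ← mul_kronecker_mul, one_mul, mul_one,
    mul_one, sqrt_mul_self_of_posSemidef hR]

lemma re_trace_measuredState_nonneg (Γ : Strategy d e A B X Y) (b : B) (y : Y) :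
    0 ≤ (Γ.measuredState b y).trace.re :=
  (Complex.le_def.mp (Γ.posSemidef_measuredState b y).trace_nonneg).1

lemma sum_re_trace_measuredState (Γ : Strategy d e A B X Y) (b : B) :
    ∑ y, (Γ.measuredState b y).trace.re = 1 := by
  have h : ∀ y, (Γ.measuredState b y).trace = (((1 : Matrix d d ℂ) ⊗ₖ Γ.S b y) * Γ.γ).trace :=
    fun y => by rw [← trace_kronecker_one_mul_measuredState, one_kronecker_one, one_mul]
  simp only [h]
  rw [← Complex.re_sum, ← trace_sum, ← Finset.sum_mul, ← kronecker_sum, (Γ.S_povm b).2,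
    one_kronecker_one, one_mul, Γ.γ_density.2, Complex.one_re]

lemma nonempty_prod (Γ : Strategy d e A B X Y) : Nonempty (d × e) := by
  by_contra h
  rw [not_nonempty_iff] at h
  have := Γ.γ_density.2
  simp [trace] at this

lemma nonempty_outcomes (Γ : Strategy d e A B X Y) (a : A) : Nonempty X := by
  obtain ⟨i, -⟩ := Γ.nonempty_prod
  by_contra h
  rw [not_nonempty_iff] at h
  have := congrFun (congrFun (Γ.R_povm a).2 i) i
  simp at this

/-- The expected disturbance, seen by a first-player effect that may depend on the second player's
outcome, which is caused by performing the measurement `R a`. -/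
lemma sum_trace_disturbance_le (Γ : Strategy d e A B X Y) (a : A) (b : B) {Z : Y → Matrix d d ℂ}
    (hZ : ∀ y, (Z y).PosSemidef) (hZ' : ∀ y, (1 - Z y).PosSemidef) :
    ∑ y, (((Z y - ∑ x, CFC.sqrt (Γ.R a x) * Z y * CFC.sqrt (Γ.R a x)) ⊗ₖ Γ.S b y)
        * Γ.γ).trace.re
      ≤ √2 * √(1 - ∑ y, optDist (fun x => Γ.secondPlayerState a b x y)) := by
  classical
  obtain ⟨x₀⟩ := Γ.nonempty_outcomes a
  set p : Y → ℝ := fun y => (Γ.measuredState b y).trace.re with hp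
  set D : Y → ℝ := fun y => optDist (fun x => Γ.secondPlayerState a b x y) with hD
  set K : Y → ℝ := fun y => (((Z y - ∑ x, CFC.sqrt (Γ.R a x) * Z y * CFC.sqrt (Γ.R a x))
    ⊗ₖ Γ.S b y) * Γ.γ).trace.re with hK
  have hp0 : ∀ y, 0 ≤ p y := Γ.re_trace_measuredState_nonneg b
  have hT : ∀ y (T : X → Matrix e e ℂ), IsPOVM T →
      K y ^ 2 ≤ 2 * p y * (p y - ∑ x, ((T x * Γ.secondPlayerState a b x y).trace).re) ∧
        ∑ x, ((T x * Γ.secondPlayerState a b x y).trace).re ≤ p y := by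
    intro y T hT
    have := sq_trace_disturbance_le (Γ.posSemidef_measuredState b y) (hZ y) (hZ' y)
      (Γ.R_povm a) hT
    simpa only [trace_kronecker_one_mul_measuredState, ← trace_mul_secondPlayerState] using this
  have hne : ∀ y, {r : ℝ | ∃ T : X → Matrix e e ℂ, IsPOVM T ∧
      r = ∑ x, ((T x * Γ.secondPlayerState a b x y).trace).re}.Nonempty := fun y => by
    -- The POVM that always guesses `x₀`.
    refine ⟨_, fun x => if x = x₀ then 1 else 0, ⟨fun x => ?_, by simp⟩, rfl⟩
    dsimp only
    split_ifs
    exacts [PosSemidef.one, PosSemidef.zero]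
  have hDp : ∀ y, D y ≤ p y := fun y => csSup_le (hne y) (by
    rintro _ ⟨T, h, rfl⟩
    exact (hT y T h).2)
  have hKD : ∀ y, K y ^ 2 ≤ 2 * p y * (p y - D y) := fun y => by
    -- Passing to the supremum over `T` divides by `2 p y`, so outcomes of probability zero are
    -- treated separately.
    rcases (hp0 y).eq_or_lt with h0 | hpos
    · obtain ⟨_, T, h, -⟩ := hne y
      have := (hT y T h).1
      rw [← h0] at this ⊢
      simpa using this
    · have : D y ≤ p y - K y ^ 2 / (2 * p y) := csSup_le (hne y) (by
        rintro _ ⟨T, h, rfl⟩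
        have := (hT y T h).1
        rw [le_sub_comm, div_le_iff₀ (by positivity)]
        linarith)
      rw [le_sub_comm, div_le_iff₀ (by positivity)] at this
      linarith
  calc ∑ y, K y ≤ ∑ y, √2 * (√(p y) * √(p y - D y)) := Finset.sum_le_sum fun y _ => by
        rw [← Real.sqrt_mul (hp0 y), ← Real.sqrt_mul zero_le_two, ← mul_assoc]
        exact Real.le_sqrt_of_sq_le (hKD y)
    _ = √2 * ∑ y, √(p y) * √(p y - D y) := by rw [Finset.mul_sum]
    -- Cauchy–Schwarz over `y`; the probabilities `p y` sum to one.
    _ ≤ √2 * (√(∑ y, p y) * √(∑ y, (p y - D y))) :=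
        mul_le_mul_of_nonneg_left (Real.sum_sqrt_mul_sqrt_le _ hp0
          fun y => sub_nonneg.mpr (hDp y)) (Real.sqrt_nonneg _)
    _ = √2 * √(1 - ∑ y, D y) := by
        rw [Finset.sum_sub_distrib, Γ.sum_re_trace_measuredState b, Real.sqrt_one, one_mul]

lemma sum_optDist_le_one (Γ : Strategy d e A B X Y) (a : A) (b : B) :
    ∑ y, optDist (fun x => Γ.secondPlayerState a b x y) ≤ 1 := by
  rw [← Γ.sum_re_trace_measuredState b]
  refine Finset.sum_le_sum fun y _ => Real.sSup_le ?_ (Γ.re_trace_measuredState_nonneg b y)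
  rintro _ ⟨T, h, rfl⟩
  -- Only the second conclusion is needed, and it does not involve `Z`; any effect would do.
  have := (sq_trace_disturbance_le (Γ.posSemidef_measuredState b y) PosSemidef.one
    (by rw [sub_self]; exact PosSemidef.zero) (Γ.R_povm a) h).2
  simpa only [← trace_mul_secondPlayerState] using this

end Strategy

/-! ### Sequential measurements. -/

section JointMeasurement

variable {d Ω X : Type*} [Fintype d] [DecidableEq d] [Fintype Ω] [Fintype X]

lemma IsPOVM.posSemidef_weighted {ι : Type*} [DecidableEq ι] {M : Ω → Matrix ι ι ℂ} (hM : IsPOVM M)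
    {f : Ω → ℝ} (hf : ∀ ω, 0 ≤ f ω) : (∑ ω, (f ω : ℂ) • M ω).PosSemidef :=
  posSemidef_sum _ fun ω _ => (hM.1 ω).smul (by exact_mod_cast hf ω)

lemma IsPOVM.posSemidef_one_sub_weighted {ι : Type*} [DecidableEq ι] {M : Ω → Matrix ι ι ℂ}
    (hM : IsPOVM M) {f : Ω → ℝ} (hf : ∀ ω, f ω ≤ 1) :
    (1 - ∑ ω, (f ω : ℂ) • M ω).PosSemidef := by
  have := hM.posSemidef_weighted fun ω => sub_nonneg.mpr (hf ω)
  rw [← hM.2, ← Finset.sum_sub_distrib]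
  convert this using 3 with ω
  push_cast
  rw [sub_smul, one_smul]

/-- Measuring `R` and then `M` is a POVM. -/
lemma IsPOVM.sequential {R : X → Matrix d d ℂ} {M : Ω → Matrix d d ℂ} (hR : IsPOVM R)
    (hM : IsPOVM M) :
    IsPOVM fun z : X × Ω => CFC.sqrt (R z.1) * M z.2 * CFC.sqrt (R z.1) := by
  constructor
  · intro z
    have := (hM.1 z.2).mul_mul_conjTranspose_same (CFC.sqrt (R z.1))
    rwa [(posSemidef_sqrt (R z.1)).isHermitian.eq] at this
  · simp only [Fintype.sum_prod_type, ← Finset.sum_mul, ← Finset.mul_sum, hM.2, mul_one,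
      sqrt_mul_self_of_posSemidef (hR.1 _), hR.2]

end JointMeasurement

universe u in
/-- Measuring the first player's POVMs one after another gives a single measurement which
simulates all of them, up to the disturbance that each of them causes. -/
lemma Strategy.exists_joint_measurement {d e A B Y : Type*} {X : Type u} [Fintype d] [DecidableEq d]
    [Fintype e] [DecidableEq e] [Fintype X] [Fintype Y] [Nonempty X]
    (Γ : Strategy d e A B X Y) (s : Finset A) :
    ∃ (Ω : Type u) (_ : Fintype Ω) (M : Ω → Matrix d d ℂ) (r : A → Ω → X), IsPOVM M ∧
      ∀ a ∈ s, ∀ b, ∀ h : X → Y → ℝ, (∀ x y, 0 ≤ h x y) → (∀ x y, h x y ≤ 1) →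
        ∑ y, (((∑ x, (h x y : ℂ) • Γ.R a x - ∑ ω, (h (r a ω) y : ℂ) • M ω) ⊗ₖ Γ.S b y)
            * Γ.γ).trace.re
          ≤ ∑ a' ∈ s, √2 * √(1 - ∑ y, optDist (fun x => Γ.secondPlayerState a' b x y)) := by
  classical
  induction s using Finset.induction_on with
  | empty =>
    exact ⟨PUnit, inferInstance, fun _ => 1, fun _ _ => Classical.arbitrary X,
      ⟨fun _ => PosSemidef.one, by simp⟩, by simp⟩
  | insert a₀ s ha₀ ih =>
    obtain ⟨Ω, _, M, r, hM, hr⟩ := ih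
    -- The new POVM is measured before the old joint measurement: its own statistics are then exact,
    -- and the older replies suffer just one further disturbance.
    refine ⟨X × Ω, inferInstance, fun z => CFC.sqrt (Γ.R a₀ z.1) * M z.2 * CFC.sqrt (Γ.R a₀ z.1),
      fun a z => if a = a₀ then z.1 else r a z.2, (Γ.R_povm a₀).sequential hM, ?_⟩
    intro a ha b h h0 h1
    beta_reduce
    rw [Finset.sum_insert ha₀]
    by_cases haa : a = a₀
    · subst haa
      have hdiff : ∀ y, ∑ x, (h x y : ℂ) • Γ.R a x - ∑ z : X × Ω,
          (h z.1 y : ℂ) • (CFC.sqrt (Γ.R a z.1) * M z.2 * CFC.sqrt (Γ.R a z.1)) = 0 := fun y => by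
        simp only [Fintype.sum_prod_type, ← Finset.smul_sum, ← Finset.sum_mul,
          ← Finset.mul_sum, hM.2, mul_one, sqrt_mul_self_of_posSemidef ((Γ.R_povm a).1 _),
          sub_self]
      simp only [↓reduceIte, hdiff, zero_kronecker, zero_mul, trace_zero, Complex.zero_re,
        Finset.sum_const_zero]
      positivity
    · have hs := hr a ((Finset.mem_insert.mp ha).resolve_left haa) b h h0 h1
      -- The effect disturbed by `R a₀` is the score-weighted joint measurement, which depends on
      -- `y` through `h`.
      have hd := Γ.sum_trace_disturbance_le a₀ b (Z := fun y => ∑ ω, (h (r a ω) y : ℂ) • M ω)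
        (fun y => hM.posSemidef_weighted fun ω => h0 _ _)
        (fun y => hM.posSemidef_one_sub_weighted fun ω => h1 _ _)
      refine le_trans (le_of_eq ?_) (add_le_add hd hs)
      rw [← Finset.sum_add_distrib]
      refine Finset.sum_congr rfl fun y _ => ?_
      have : ∑ z : X × Ω, (h (if a = a₀ then z.1 else r a z.2) y : ℂ) •
            (CFC.sqrt (Γ.R a₀ z.1) * M z.2 * CFC.sqrt (Γ.R a₀ z.1)) =
          ∑ x, CFC.sqrt (Γ.R a₀ x) * (∑ ω, (h (r a ω) y : ℂ) • M ω) * CFC.sqrt (Γ.R a₀ x) := by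
        simp only [if_neg haa, Fintype.sum_prod_type, Finset.mul_sum, Finset.sum_mul,
          mul_smul_comm, smul_mul_assoc]
      rw [this, ← Complex.add_re, ← trace_add, ← add_mul]
      simp only [sub_kronecker]
      congr 4
      abel

/-! ### Classical correlations from shared randomness. -/

lemma trace_submatrix_equiv_self {m n : Type*} [Fintype m] [Fintype n] (e : m ≃ n)
    (M : Matrix n n ℂ) : (M.submatrix e e).trace = M.trace :=
  Fintype.sum_equiv e _ _ fun _ => rfl

lemma IsDensity.submatrix {m n : Type*} [Fintype m] [Fintype n] {M : Matrix n n ℂ}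
    (hM : IsDensity M) (e : m ≃ n) : IsDensity (M.submatrix e e) :=
  ⟨hM.1.submatrix e, by rw [trace_submatrix_equiv_self, hM.2]⟩

lemma IsPOVM.submatrix {m n X : Type*} [DecidableEq m] [DecidableEq n] [Fintype X]
    {T : X → Matrix n n ℂ} (hT : IsPOVM T) (e : m ≃ n) :
    IsPOVM fun x => (T x).submatrix e e := by
  refine ⟨fun x => (hT.1 x).submatrix e, ?_⟩
  have : ∑ x, (T x).submatrix e e = (∑ x, T x).submatrix e e := by
    ext i j
    simp [Matrix.sum_apply]
  rw [this, hT.2, submatrix_one_equiv]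

lemma PosSemidef.exists_density {e : Type*} [Fintype e] [DecidableEq e] [Nonempty e]
    {N : Matrix e e ℂ} (hN : N.PosSemidef) :
    ∃ β : Matrix e e ℂ, IsDensity β ∧ N = (N.trace.re : ℂ) • β := by
  have htr : (N.trace.re : ℂ) = N.trace :=
    Complex.ext rfl (by simpa using (Complex.le_def.mp hN.trace_nonneg).2)
  have h0 : 0 ≤ N.trace.re := (Complex.le_def.mp hN.trace_nonneg).1
  by_cases h : N.trace = 0
  -- Here `N = 0` and its weight vanishes, so any density serves; the maximally mixed one is taken.
  · refine ⟨((Fintype.card e : ℝ)⁻¹ : ℂ) • 1, ⟨PosSemidef.one.smul ?_, ?_⟩, ?_⟩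
    · rw [← Complex.ofReal_inv]
      exact_mod_cast inv_nonneg.mpr (Nat.cast_nonneg (Fintype.card e))
    · simp [trace_smul]
    · rw [htr, h, zero_smul]
      exact hN.trace_eq_zero_iff.mp h
  · refine ⟨((N.trace.re)⁻¹ : ℂ) • N, ⟨hN.smul ?_, ?_⟩, ?_⟩
    · exact_mod_cast inv_nonneg.mpr h0
    · rw [trace_smul, htr, smul_eq_mul, inv_mul_cancel₀ h]
    · rw [htr, smul_smul, mul_inv_cancel₀ h, one_smul]

lemma IsDensity.kronecker {d e : Type*} [Fintype d] [Fintype e]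
    {α : Matrix d d ℂ} {β : Matrix e e ℂ} (hα : IsDensity α) (hβ : IsDensity β) :
    IsDensity (α ⊗ₖ β) :=
  ⟨posSemidef_kronecker hα.1 hβ.1, by rw [trace_kronecker, hα.2, hβ.2, one_mul]⟩

lemma IsDensity.convexCombination {n ι : Type*} [Fintype n] [Fintype ι] {w : ι → ℝ}
    {ρ : ι → Matrix n n ℂ} (hw : ∀ k, 0 ≤ w k) (hw1 : ∑ k, w k = 1) (hρ : ∀ k, IsDensity (ρ k)) :
    IsDensity (∑ k, (w k : ℂ) • ρ k) := by
  refine ⟨posSemidef_sum _ fun k _ => (hρ k).1.smul (by exact_mod_cast hw k), ?_⟩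
  simp only [trace_sum, trace_smul, (hρ _).2, smul_eq_mul, mul_one]
  exact_mod_cast hw1

/-- A shared random variable `k`, a response of the first player to `k`, and a measurement of the
second player on a state depending on `k` give a classical correlation. -/
lemma isClassical_of_mixture {e A B X Y : Type*} [Fintype e] [DecidableEq e] [Fintype X]
    [DecidableEq X] [Fintype Y] {n : ℕ} {w : Fin n → ℝ} {β : Fin n → Matrix e e ℂ}
    {S : B → Y → Matrix e e ℂ} (hw : ∀ k, 0 ≤ w k) (hw1 : ∑ k, w k = 1)
    (hβ : ∀ k, IsDensity (β k)) (hS : ∀ b, IsPOVM (S b)) (r : A → Fin n → X) :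
    IsClassical fun a b x y => ∑ k, if r a k = x then w k * (S b y * β k).trace.re else 0 := by
  let E := (Fintype.equivFin e).symm
  -- The first player's register stores `k` as a basis state, to be read off by a diagonal
  -- measurement.
  let α : Fin n → Matrix (Fin n) (Fin n) ℂ := fun k => diagonal (Pi.single k 1)
  have hα : ∀ k, IsDensity (α k) := fun k => by
    refine ⟨PosSemidef.diagonal (Pi.single_nonneg.mpr zero_le_one), ?_⟩
    rw [trace_diagonal, Finset.sum_pi_single' k]
    simp
  let γ := ∑ k, (w k : ℂ) • (α k ⊗ₖ (β k).submatrix E E)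
  have hR : ∀ a, IsPOVM fun x => (diagonal fun k => if r a k = x then 1 else 0 :
      Matrix (Fin n) (Fin n) ℂ) := fun a => by
    refine ⟨fun x => PosSemidef.diagonal fun k => ?_, ?_⟩
    · dsimp only
      split_ifs <;> simp
    · ext i j
      by_cases hij : i = j
      · subst hij
        simp [Matrix.sum_apply]
      · simp [Matrix.sum_apply, hij]
  refine ⟨n, Fintype.card e, ⟨_, _, γ, hR, fun b => (hS b).submatrix E,
    IsDensity.convexCombination hw hw1 fun k => (hα k).kronecker ((hβ k).submatrix E)⟩,
    ⟨n, w, α, _, hw, hw1, hα, fun k => (hβ k).submatrix E, rfl⟩, ?_⟩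
  ext a b x y
  simp only [Strategy.correlation, γ, Finset.mul_sum, mul_smul_comm, ← mul_kronecker_mul, trace_sum,
    trace_smul, trace_kronecker, Complex.re_sum, smul_eq_mul, Complex.re_ofReal_mul]
  refine Finset.sum_congr rfl fun k _ => ?_
  have h1 : ((diagonal fun k => if r a k = x then 1 else 0) * α k).trace
      = if r a k = x then (1 : ℂ) else 0 := by
    simp [α, trace_diagonal, diagonal_mul_diagonal, Pi.single_apply]
  rw [h1, submatrix_mul_equiv, trace_submatrix_equiv_self]
  split_ifs <;> simp

namespace Strategy

variable {d e A B X Y : Type*} [Fintype d] [DecidableEq d] [Fintype e] [DecidableEq e]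
  [Fintype X] [Fintype Y]

lemma correlation_nonneg (Γ : Strategy d e A B X Y) (a : A) (b : B) (x : X) (y : Y) :
    0 ≤ Γ.correlation a b x y :=
  trace_mul_re_nonneg (posSemidef_kronecker ((Γ.R_povm a).1 x) ((Γ.S_povm b).1 y)) Γ.γ_density.1

lemma sum_correlation (Γ : Strategy d e A B X Y) (a : A) (b : B) :
    ∑ x, ∑ y, Γ.correlation a b x y = 1 := by
  simp only [correlation, ← Complex.re_sum, ← trace_sum, ← Finset.sum_mul, ← kronecker_sum,
    ← sum_kronecker, (Γ.S_povm b).2, (Γ.R_povm a).2, one_kronecker_one, one_mul, Γ.γ_density.2,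
    Complex.one_re]

/-- Replacing the first player's measurements by classical processing of the outcome of a single
measurement gives a classical correlation. -/
lemma isClassical_of_joint_measurement {Ω : Type*} [Fintype Ω] [DecidableEq X]
    (Γ : Strategy d e A B X Y) {M : Ω → Matrix d d ℂ} (hM : IsPOVM M) (r : A → Ω → X) :
    IsClassical fun a b x y =>
      ∑ ω, if r a ω = x then ((M ω ⊗ₖ Γ.S b y) * Γ.γ).trace.re else 0 := by
  have : Nonempty e := Γ.nonempty_prod.map Prod.snd
  -- The unnormalized state of `E` after outcome `ω`; its trace is the probability of `ω`.
  let N : Ω → Matrix e e ℂ := fun ω => partialTraceLeft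
    ((CFC.sqrt (M ω) ⊗ₖ (1 : Matrix e e ℂ)) * Γ.γ * (CFC.sqrt (M ω) ⊗ₖ (1 : Matrix e e ℂ)))
  have hN : ∀ ω, (N ω).PosSemidef := fun ω => by
    have h := posSemidef_kronecker (posSemidef_sqrt (M ω)) (PosSemidef.one (n := e) (R := ℂ))
    have := Γ.γ_density.1.mul_mul_conjTranspose_same (CFC.sqrt (M ω) ⊗ₖ (1 : Matrix e e ℂ))
    rw [h.isHermitian.eq] at this
    exact posSemidef_partialTraceLeft this
  have hNtr : ∀ ω (W : Matrix e e ℂ), (W * N ω).trace = ((M ω ⊗ₖ W) * Γ.γ).trace := fun ω W => by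
    rw [trace_mul_partialTraceLeft, ← mul_assoc, trace_mul_comm, ← mul_assoc, ← mul_assoc,
      ← mul_kronecker_mul, ← mul_kronecker_mul, mul_one, one_mul, mul_one,
      sqrt_mul_self_of_posSemidef (hM.1 ω)]
  choose β hβ hNβ using fun ω => PosSemidef.exists_density (hN ω)
  let E := (Fintype.equivFin Ω).symm
  have hw1 : ∑ k, (N (E k)).trace.re = 1 := by
    rw [Equiv.sum_comp E fun ω => (N ω).trace.re]
    have : ∀ ω, (N ω).trace = ((M ω ⊗ₖ (1 : Matrix e e ℂ)) * Γ.γ).trace := fun ω => by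
      rw [← hNtr, one_mul]
    simp only [this]
    rw [← Complex.re_sum, ← trace_sum, ← Finset.sum_mul, ← sum_kronecker, hM.2, one_kronecker_one,
      one_mul, Γ.γ_density.2, Complex.one_re]
  have := isClassical_of_mixture (w := fun k => (N (E k)).trace.re) (β := fun k => β (E k))
    (fun k => (Complex.le_def.mp (hN (E k)).trace_nonneg).1) hw1 (fun k => hβ (E k)) Γ.S_povm
    (fun a k => r a (E k))
  convert this using 5 with a b x y
  rw [← Equiv.sum_comp E]
  refine Finset.sum_congr rfl fun k _ => ?_
  rw [← hNtr]
  conv_lhs => rw [hNβ, mul_smul_comm, trace_smul, smul_eq_mul, Complex.re_ofReal_mul]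

end Strategy

/-! ### Averaging over inputs. -/

namespace Game

variable {A B X Y : Type*} [Fintype A] [Fintype B] [Fintype X] [Fintype Y]

lemma score_le_classicalValue (G : Game A B X Y) {p : A → B → X → Y → ℝ} (hp : IsClassical p) :
    G.score p ≤ G.classicalValue := by
  -- Scores are at most one, so the supremum is a genuine upper bound.
  refine le_csSup ⟨1, ?_⟩ ⟨p, hp, rfl⟩
  rintro _ ⟨_, ⟨m, n, Γ, -, rfl⟩, rfl⟩
  calc G.score Γ.correlation ≤ ∑ a, ∑ b, ∑ x, ∑ y, G.q a b * Γ.correlation a b x y := by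
        refine Finset.sum_le_sum fun a _ => Finset.sum_le_sum fun b _ => Finset.sum_le_sum
          fun x _ => Finset.sum_le_sum fun y _ => ?_
        exact mul_le_mul_of_nonneg_right (mul_le_of_le_one_right (G.q_nonneg a b)
          (G.H_le_one a b x y)) (Γ.correlation_nonneg a b x y)
    _ = 1 := by simp only [← Finset.mul_sum, Γ.sum_correlation, mul_one, G.q_sum]

omit [Fintype X] [Fintype Y] in
lemma qB_nonneg (G : Game A B X Y) (b : B) : 0 ≤ G.qB b :=
  Finset.sum_nonneg fun a _ => G.q_nonneg a b

omit [Fintype X] [Fintype Y] in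
-- Cauchy–Schwarz over input pairs, using `(q(b) / P(a|b)) · q(a,b) = q(b)²`; complete support
-- permits the division.
lemma sum_qB_mul_sqrt_le (G : Game A B X Y) (hG : G.CompleteSupport) {ε : A → B → ℝ}
    (hε : ∀ a b, 0 ≤ ε a b) :
    ∑ a, ∑ b, G.qB b * √(ε a b) ≤
      √(∑ a, ∑ b, G.qB b * (G.condProb a b)⁻¹) * √(∑ a, ∑ b, G.q a b * ε a b) := by
  simp only [← Fintype.sum_prod_type']
  have hqB := G.qB_nonneg
  refine le_trans (le_of_eq ?_) (Real.sum_sqrt_mul_sqrt_le _ (fun z => ?_) (fun z => ?_))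
  · refine Finset.sum_congr rfl fun z _ => ?_
    have hq := hG z.1 z.2
    have h0 := hqB z.2
    have hc : 0 ≤ G.condProb z.1 z.2 := div_nonneg hq.le h0
    rw [← Real.sqrt_mul (by positivity)]
    have : G.qB z.2 * (G.condProb z.1 z.2)⁻¹ * (G.q z.1 z.2 * ε z.1 z.2) =
        G.qB z.2 ^ 2 * ε z.1 z.2 := by
      rw [condProb, inv_div]
      field_simp
    rw [this, Real.sqrt_mul (sq_nonneg _), Real.sqrt_sq h0]
  · exact mul_nonneg (hqB _) (inv_nonneg.mpr (div_nonneg (G.q_nonneg _ _) (hqB _)))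
  · exact mul_nonneg (G.q_nonneg _ _) (hε _ _)

end Game

/-- The score of a strategy exceeds the classical value by at most `C_G √ε`. -/
theorem Strategy.score_sub_classicalValue_le {A B X Y d e : Type*} [Fintype A] [Fintype B] [Fintype X] [Fintype Y]
    [Fintype d] [DecidableEq d] [Fintype e] [DecidableEq e]
    (G : Game A B X Y) (hG : G.CompleteSupport)
    (Γ : Strategy d e A B X Y) :
    G.score Γ.correlation - G.classicalValue
      ≤ G.errorConst * Real.sqrt (Γ.unguessability G) := by
  classical
  have hA : Nonempty A := by
    by_contra h
    rw [not_nonempty_iff] at h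
    simpa using G.q_sum
  have : Nonempty X := Γ.nonempty_outcomes hA.some
  obtain ⟨Ω, _, M, r, hM, hr⟩ := Γ.exists_joint_measurement Finset.univ
  set p' : A → B → X → Y → ℝ := fun a b x y =>
    ∑ ω, if r a ω = x then ((M ω ⊗ₖ Γ.S b y) * Γ.γ).trace.re else 0 with hp'
  have hcl : G.score p' ≤ G.classicalValue :=
    G.score_le_classicalValue (Γ.isClassical_of_joint_measurement hM r)
  set ε : A → B → ℝ := fun a b => 1 - ∑ y, optDist (fun x => Γ.secondPlayerState a b x y) with hε
  have hε0 : ∀ a b, 0 ≤ ε a b := fun a b => sub_nonneg.mpr (Γ.sum_optDist_le_one a b)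
  have hεsum : ∑ a, ∑ b, G.q a b * ε a b = Γ.unguessability G := by
    simp only [hε, mul_sub, mul_one, Finset.sum_sub_distrib, G.q_sum, Strategy.unguessability]
  have hab : ∀ a b, ∑ x, ∑ y, G.H a b x y * (Γ.correlation a b x y - p' a b x y)
      ≤ ∑ a', √2 * √(ε a' b) := fun a b => by
    refine le_trans (le_of_eq ?_)
      (hr a (Finset.mem_univ a) b (G.H a b) (G.H_nonneg a b) (G.H_le_one a b))
    rw [Finset.sum_comm]
    refine Finset.sum_congr rfl fun y _ => ?_
    simp only [mul_sub, Finset.sum_sub_distrib, sub_kronecker, sum_kronecker, smul_kronecker,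
      sub_mul, Finset.sum_mul, smul_mul_assoc, trace_sub, trace_sum, trace_smul, Complex.sub_re,
      Complex.re_sum, smul_eq_mul, Complex.re_ofReal_mul, Strategy.correlation, hp',
      Finset.mul_sum, mul_ite, mul_zero]
    congr 1
    rw [Finset.sum_comm]
    simp
  have hscore : G.score Γ.correlation - G.score p' ≤ √2 * ∑ a, ∑ b, G.qB b * √(ε a b) := by
    calc G.score Γ.correlation - G.score p'
        = ∑ a, ∑ b, G.q a b *
            ∑ x, ∑ y, G.H a b x y * (Γ.correlation a b x y - p' a b x y) := by
          simp only [Game.score, ← Finset.sum_sub_distrib, Finset.mul_sum, mul_sub, mul_assoc]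
      _ ≤ ∑ a, ∑ b, G.q a b * ∑ a', √2 * √(ε a' b) :=
          Finset.sum_le_sum fun a _ => Finset.sum_le_sum fun b _ =>
            mul_le_mul_of_nonneg_left (hab a b) (G.q_nonneg a b)
      _ = √2 * ∑ a, ∑ b, G.qB b * √(ε a b) := by
          rw [Finset.sum_comm]
          simp only [← Finset.sum_mul, ← Finset.mul_sum]
          rw [Finset.sum_comm, Finset.mul_sum]
          refine Finset.sum_congr rfl fun b _ => ?_
          rw [← Finset.mul_sum, Game.qB]
          ring
  -- The argument yields the constant `√2`, which is rounded up to the `3/2` in `C_G`.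
  have hsqrt : √2 ≤ 3 / 2 := Real.sqrt_le_iff.mpr ⟨by norm_num, by norm_num⟩
  calc G.score Γ.correlation - G.classicalValue
      ≤ √2 * ∑ a, ∑ b, G.qB b * √(ε a b) := by linarith
    _ ≤ 3 / 2 * (√(∑ a, ∑ b, G.qB b * (G.condProb a b)⁻¹) * √(Γ.unguessability G)) := by
        rw [← hεsum]
        refine mul_le_mul hsqrt (G.sum_qB_mul_sqrt_le hG hε0) ?_ (by norm_num)
        exact Finset.sum_nonneg fun a _ => Finset.sum_nonneg fun b _ =>
          mul_nonneg (G.qB_nonneg b) (Real.sqrt_nonneg _)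
    _ = G.errorConst * √(Γ.unguessability G) := by rw [Game.errorConst, mul_assoc]

end NonlocalGame

theorem theorem1 {A B X Y d e : Type*} [Fintype A] [Fintype B] [Fintype X] [Fintype Y]
    [Fintype d] [DecidableEq d] [Fintype e] [DecidableEq e]
    (G : NonlocalGame.Game A B X Y) (hG : G.CompleteSupport)
    (Γ : NonlocalGame.Strategy d e A B X Y) :
    G.score Γ.correlation - G.classicalValue
      ≤ G.errorConst * Real.sqrt (Γ.unguessability G) :=
  Γ.score_sub_classicalValue_le G hG
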